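/- Let $\mathfrak g$ be the real Lie algebra of type A8 (U3I2), i.e. with a basis $X_1,\dots,X_4$ such that $[X_1,X_2]=X_3$, $[X_3,X_1]=X_2$, $[X_2,X_3]=-X_4$ and $X_4$ is central. Metrics are left-invariant Riemannian metrics on a Lie group with Lie algebra $\mathfrak g$ (or the metrics they induce on closed quotients of it by lattices), i.e. inner products on $\mathfrak g$, and a Ricci flow is a solution of $\partial g/\partial t=-2\,\mathrm{Ric}(g)$ on $[0,\infty)$ by such metrics. For two Ricci flows write $\bar g\in[g]$ ($\bar g$ quasi-converges to $g$) if for every $\varepsilon>0$ there is a time $t_\varepsilon$ with $\sup_{t\ge t_\varepsilon}|\bar g(t)-g(t)|_{g(t)}<\varepsilon$. For real $a_1,a_3,a_6$ let $Y(a_1,a_3,a_6)$ be the frame $$Y_1=X_1+a_3X_2+a_1X_3+a_6X_4,\quad Y_2=X_2+a_3X_4,\quad Y_3=X_3+a_1X_4,\quad Y_4=X_4 .$$ **Theorem 9.1.** Let $g$ be a Ricci flow whose initial metric is diagonal in the frame $Y(a_1,a_3,a_6)$ with diagonal entries $\lambda_1,\dots,\lambda_4$. 1. Let $\bar g$ be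 a Ricci flow whose initial metric is diagonal in the frame $Y(a_1',a_3',a_6')$ with diagonal entries $\bar\lambda_1,\dots,\bar\lambda_4$. Put $a=a_3-a_3'$ and $b=a_1-a_1'$. Then $\bar g\in[g]$ if and only if $a=b=0$ and $$\bar\lambda_2\bar\lambda_3\bar\lambda_4^2=\lambda_2\lambda_3\lambda_4^2,\qquad \bar\lambda_1\bar\lambda_4(\bar\lambda_2+\bar\lambda_3)=\lambda_1\lambda_4(\lambda_2+\lambda_3).$$ 2. Let $a_1',a_3',a_6'$ be such that $a=b=0$ (with no condition on $a_6'$). Then the set of diagonal entries $(\bar\lambda_1,\dots,\bar\lambda_4)$ in the frame $Y(a_1',a_3',a_6')$ of initial metrics of Ricci flows $\bar g\in[g]$ is exactly a $2$-parameter family: it is the set of all positive solutions $(\bar\lambda_1,\dots,\bar\lambda_4)$ of the two equations above (in particular, each of these data is the initial datum of a Ricci flow that exists for all $t\ge 0$ and belongs to $[g]$), and it is a smooth graph over $(\bar\lambda_2,\bar\lambda_4)\in(0,\infty)^2$. -/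

import Mathlib

open Set Module
open scoped ContDiff ENNReal

noncomputable section

/-- A left-invariant Riemannian metric on a Lie group with Lie algebra `L`, given by its value at
the identity: an inner product on `L`.  (Equivalently, a metric on a quotient of the group by a
discrete subgroup that lifts to a left-invariant one.) -/
structure InvMetric (L : Type*) [LieRing L] [LieAlgebra ℝ L] where
  form : LinearMap.BilinForm ℝ L
  symm : ∀ x y, form x y = form y x
  pos : ∀ x, x ≠ 0 → 0 < form x x

namespace InvMetric

variable {L : Type*} [LieRing L] [LieAlgebra ℝ L]

theorem nondegenerate (g : InvMetric L) : g.form.Nondegenerate := by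
  refine ⟨fun x hx => ?_, fun x hx => ?_⟩
  all_goals
    by_contra h
    exact (g.pos x h).ne' (hx x)

variable [FiniteDimensional ℝ L]

/-- The musical isomorphism `L* ≃ L` (raising an index): `g (g.sharp φ) z = φ z`. -/
def sharp (g : InvMetric L) : Dual ℝ L ≃ₗ[ℝ] L :=
  (g.form.toDual g.nondegenerate).symm

/-- The linear form `z ↦ ½ (⟨[x,y],z⟩ - ⟨[y,z],x⟩ + ⟨[z,x],y⟩)`, that is, `z ↦ ⟨∇_x y, z⟩` by the
Koszul formula for left-invariant vector fields. -/
def koszul (g : InvMetric L) (x y : L) : Dual ℝ L where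
  toFun z := (1 / 2 : ℝ) * (g.form ⁅x, y⁆ z - g.form ⁅y, z⁆ x + g.form ⁅z, x⁆ y)
  map_add' z w := by simp only [lie_add, add_lie, map_add, LinearMap.add_apply]; ring
  map_smul' c z := by
    simp only [lie_smul, smul_lie, map_smul, LinearMap.smul_apply, smul_eq_mul, RingHom.id_apply]
    ring

/-- The Levi-Civita connection `(x, y) ↦ ∇_x y` on left-invariant vector fields. -/
def nabla (g : InvMetric L) : L →ₗ[ℝ] L →ₗ[ℝ] L :=
  LinearMap.mk₂ ℝ (fun x y => g.sharp (g.koszul x y))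
    (fun x x' y => by
      rw [← map_add]; congr 1; ext z
      simp only [koszul, LinearMap.coe_mk, AddHom.coe_mk, LinearMap.add_apply, lie_add, add_lie,
        map_add]
      ring)
    (fun c x y => by
      rw [← map_smul]; congr 1; ext z
      simp only [koszul, LinearMap.coe_mk, AddHom.coe_mk, LinearMap.smul_apply, lie_smul, smul_lie,
        map_smul, smul_eq_mul]
      ring)
    (fun x y y' => by
      rw [← map_add]; congr 1; ext z
      simp only [koszul, LinearMap.coe_mk, AddHom.coe_mk, LinearMap.add_apply, lie_add, add_lie,
        map_add]
      ring)
    (fun c x y => by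
      rw [← map_smul]; congr 1; ext z
      simp only [koszul, LinearMap.coe_mk, AddHom.coe_mk, LinearMap.smul_apply, lie_smul, smul_lie,
        map_smul, smul_eq_mul]
      ring)

/-- The linear map `z ↦ R(z, x) y = ∇_z ∇_x y - ∇_x ∇_z y - ∇_[z,x] y`. -/
def curvature (g : InvMetric L) (x y : L) : L →ₗ[ℝ] L where
  toFun z := g.nabla z (g.nabla x y) - g.nabla x (g.nabla z y) - g.nabla ⁅z, x⁆ y
  map_add' z w := by simp only [add_lie, map_add, LinearMap.add_apply]; abel
  map_smul' c z := by
    simp only [smul_lie, map_smul, LinearMap.smul_apply, RingHom.id_apply, smul_sub]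

/-- The Ricci tensor `Ric(x, y) = tr (z ↦ R(z, x) y)`. -/
def ricci (g : InvMetric L) (x y : L) : ℝ :=
  LinearMap.trace ℝ L (g.curvature x y)

/-- The norm `|T|_g` of a `(0,2)`-tensor, `|T|_g² = g^{ik} g^{jl} T_ij T_kl`, written as the square
root of the trace of the composition of the endomorphisms obtained by raising one index of `T`
and of its transpose. -/
def tensorNorm (g : InvMetric L) (T : LinearMap.BilinForm ℝ L) : ℝ :=
  Real.sqrt (LinearMap.trace ℝ L
    ((g.sharp.toLinearMap ∘ₗ T.flip) ∘ₗ (g.sharp.toLinearMap ∘ₗ T)))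

/-- The metric is diagonal with respect to the frame `Y`, with diagonal entries `lam`. -/
def IsDiagonal {L : Type*} [LieRing L] [LieAlgebra ℝ L] (g : InvMetric L) (Y : Fin 4 → L)
    (lam : Fin 4 → ℝ) : Prop :=
  ∀ i j, g.form (Y i) (Y j) = if i = j then lam i else 0

end InvMetric

/-- `g` solves the Ricci flow `∂g/∂t = -2 Ric(g)` on the time interval `[0, ∞)`
(with the one-sided derivative at `0`). -/
def IsRicciFlow {L : Type*} [LieRing L] [LieAlgebra ℝ L] [FiniteDimensional ℝ L]
    (g : ℝ → InvMetric L) : Prop :=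
  ∀ t, 0 ≤ t → ∀ x y,
    HasDerivWithinAt (fun s => (g s).form x y) (-2 * (g t).ricci x y) (Ici 0) t

/-- Quasi-convergence `g ∈ [h]`: for every `ε > 0` there is a time `T` such that the supremum of
`|g - h|_h` from time `T` on is less than `ε`.  For left-invariant metrics the function
`|g - h|_h` is constant in space, so that the supremum runs over time only. -/
def QuasiConverges {L : Type*} [LieRing L] [LieAlgebra ℝ L] [FiniteDimensional ℝ L]
    (g h : ℝ → InvMetric L) : Prop :=
  ∀ ε : ℝ, 0 < ε → ∃ T : ℝ, 0 ≤ T ∧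
    ⨆ t ∈ Ici T, ENNReal.ofReal ((h t).tensorNorm ((g t).form - (h t).form)) < ENNReal.ofReal ε

/-- The characteristic bracket relations of the geometry `U3I2`: `X₁` acts by rotations on the
Heisenberg algebra spanned by `X₂, X₃, X₄`, with centre `X₄`.  (`X 0, …, X 3` are `X₁, …, X₄`.) -/
structure IsU3I2Basis {L : Type*} [LieRing L] [LieAlgebra ℝ L] (X : Basis (Fin 4) ℝ L) :
    Prop where
  lie_12 : ⁅X 0, X 1⁆ = X 2
  lie_31 : ⁅X 2, X 0⁆ = X 1
  lie_23 : ⁅X 1, X 2⁆ = -X 3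
  lie_4 : ∀ i, ⁅X 3, X i⁆ = 0

/-- The matrix `Λ` that passes from the basis `X` to the diagonalizing frame. -/
def frameMatrix (a₁ a₃ a₆ : ℝ) : Matrix (Fin 4) (Fin 4) ℝ :=
  !![1, a₃, a₁, a₆;
     0, 1, 0, a₃;
     0, 0, 1, a₁;
     0, 0, 0, 1]

/-- The frame `Y_i = Σ_k Λ_i^k X_k`. -/
def frame {L : Type*} [LieRing L] [LieAlgebra ℝ L] (X : Basis (Fin 4) ℝ L) (a₁ a₃ a₆ : ℝ) :
    Fin 4 → L :=
  fun i => ∑ k, frameMatrix a₁ a₃ a₆ i k • X k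

/-- The initial data `lam` for which there is a Ricci flow in the quasi-convergence class `[g]`
that starts at the metric which is diagonal in the frame `Y` with entries `lam`. -/
def classData {L : Type*} [LieRing L] [LieAlgebra ℝ L] [FiniteDimensional ℝ L]
    (Y : Fin 4 → L) (g : ℝ → InvMetric L) : Set (Fin 4 → ℝ) :=
  {lam | ∃ g' : ℝ → InvMetric L, IsRicciFlow g' ∧ (g' 0).IsDiagonal Y lam ∧ QuasiConverges g' g}

end

/-!
The frame `Y(a₁, a₃, a₆)` is the image of `X` under an automorphism of the Lie algebra
(`IsU3I2Basis.exists_frame`), so that its brackets are those of `X`, and metrics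
`diag(A, B, C, D)` in it stay diagonal under the Ricci flow, which becomes
`A' = (B - C)² / (BC)`, `B' = (C² - B²) / (AC) + D/C`, `C' = (B² - C²) / (AB) + D/B`,
`D' = -D² / (BC)` (`IsU3I2Basis.ricci_diagonal`).  The quantities `K² = B C D²` and
`M = A D (B + C)` are conserved.

The system is solved in closed form, up to the inverse of `x ↦ x - tanh x`
(`IsU3I2Basis.exists_diagonal_flow`): the function `S = √(BC)` satisfies `S' = K / S²`, while
`q = (√B - √C) / (√B + √C)` satisfies an autonomous equation that drives it to `0`, and
`A`, `B`, `C`, `D` are functions of `S` and `q`.  The solution exists for all `t ≥ 0`, with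
`A → M / (2K)`, `B, C ~ (3 K t)^{1/3}` and `D ~ K (3 K t)^{-1/3}`.  As the components of the Ricci
tensor are rational functions of those of the metric, the flow is determined by its initial metric
(`IsRicciFlow.eq_of_eq_zero`), so that these are all the flows with diagonal initial metric.

For two such flows, in the frames `Y` and `Y'`, quasi-convergence means that
`T_ij² / (d_i d_j) → 0` for all components, in the frame `Y`, of the difference `T`
(`quasiConverges_iff_components`).  The component `T₁₁` contains `a² B' + b² C'` (the primes now
denote the second flow), which is unbounded unless `a = b = 0`; after that, `T₂₂` compares the
constants `K`, and `T₁₁` the limits `M / (2K)` of `A`.  The parameter `a₆` only contributes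
multiples of `D' → 0` (`quasiConverges_diagonal_iff`).  Finally, the two equations between the
conserved quantities are solved for the first and third diagonal entries.
-/

/-! ### The Ricci tensor in coordinates -/

section RicciCoordinates

variable {ι : Type*} [Fintype ι] [DecidableEq ι]

/-- The coefficients `Γ_ij^k` of the Levi-Civita connection in a basis of a Lie algebra with
structure constants `c i j k`, for the left-invariant metric with Gram matrix `G`. -/
noncomputable def christoffel (c : ι → ι → ι → ℝ) (G : ι → ι → ℝ) (i j k : ι) : ℝ :=
  ∑ l, (Matrix.of G)⁻¹ k l *
    (1 / 2 * (∑ m, c i j m * G m l - ∑ m, c j l m * G m i + ∑ m, c l i m * G m j))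

/-- The components of the Ricci tensor in a basis of a Lie algebra with structure constants
`c i j k`, for the left-invariant metric with Gram matrix `G`. -/
noncomputable def ricciCoord (c : ι → ι → ι → ℝ) (G : ι → ι → ℝ) (i j : ι) : ℝ :=
  ∑ m, ∑ k, (christoffel c G i j k * christoffel c G m k m
    - christoffel c G m j k * christoffel c G i k m - c m i k * christoffel c G k j m)

variable {L : Type*} [LieRing L] [LieAlgebra ℝ L]

/-- The structure constants of a Lie algebra in a basis. -/
noncomputable def structureConst (b : Basis ι ℝ L) (i j k : ι) : ℝ := b.repr ⁅b i, b j⁆ k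

namespace InvMetric

/-- The Gram matrix of a left-invariant metric in a basis. -/
noncomputable def gram (g : InvMetric L) (b : Basis ι ℝ L) (i j : ι) : ℝ := g.form (b i) (b j)

omit [DecidableEq ι] in
theorem form_eq_sum (g : InvMetric L) (b : Basis ι ℝ L) (x : L) (j : ι) :
    g.form x (b j) = ∑ m, b.repr x m * g.gram b m j := by
  conv_lhs => rw [← b.sum_repr x]
  simp only [gram, map_sum, map_smul, LinearMap.sum_apply, LinearMap.smul_apply, smul_eq_mul]

theorem gram_det_ne_zero (g : InvMetric L) (b : Basis ι ℝ L) : (Matrix.of (g.gram b)).det ≠ 0 := by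
  have h := (LinearMap.BilinForm.nondegenerate_iff_det_ne_zero (B := g.form) b).1 g.nondegenerate
  convert! h using 2
  ext i j
  simp [gram, LinearMap.BilinForm.toMatrix_apply]

variable [FiniteDimensional ℝ L]

theorem form_sharp (g : InvMetric L) (φ : Dual ℝ L) (z : L) : g.form (g.sharp φ) z = φ z :=
  LinearMap.BilinForm.apply_toDual_symm_apply _ _

omit [Fintype ι] [DecidableEq ι] in
theorem sharp_eq_iff (g : InvMetric L) (b : Basis ι ℝ L) (φ : Dual ℝ L) (x : L) :
    g.sharp φ = x ↔ ∀ j, φ (b j) = g.form x (b j) := by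
  constructor
  · rintro rfl j
    rw [form_sharp]
  · intro h
    have : φ = g.form.toDual g.nondegenerate x := b.ext fun j => by
      rw [h j, LinearMap.BilinForm.toDual_def]
    rw [this, sharp, LinearEquiv.symm_apply_apply]

theorem repr_sharp (g : InvMetric L) (b : Basis ι ℝ L) (φ : Dual ℝ L) (k : ι) :
    b.repr (g.sharp φ) k = ∑ l, (Matrix.of (g.gram b))⁻¹ k l * φ (b l) := by
  have h : (Matrix.of (g.gram b)).mulVec (b.repr (g.sharp φ)) = fun l => φ (b l) := by
    ext l
    rw [← form_sharp g φ, form_eq_sum g b]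
    refine Finset.sum_congr rfl fun m _ => ?_
    rw [mul_comm]
    exact congrArg _ (g.symm _ _)
  have hu : IsUnit (Matrix.of (g.gram b)).det := (g.gram_det_ne_zero b).isUnit
  have := congrArg (fun v => (Matrix.of (g.gram b))⁻¹.mulVec v k) h
  simp only [Matrix.mulVec_mulVec, Matrix.nonsing_inv_mul _ hu, Matrix.one_mulVec] at this
  exact this

theorem repr_nabla (g : InvMetric L) (b : Basis ι ℝ L) (i j k : ι) :
    b.repr (g.nabla (b i) (b j)) k = christoffel (structureConst b) (g.gram b) i j k := by
  rw [nabla, LinearMap.mk₂_apply, repr_sharp, christoffel]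
  refine Finset.sum_congr rfl fun l _ => ?_
  simp only [koszul, LinearMap.coe_mk, AddHom.coe_mk, form_eq_sum g b, structureConst]

theorem nabla_basis (g : InvMetric L) (b : Basis ι ℝ L) (i j : ι) :
    g.nabla (b i) (b j) =
      ∑ k, christoffel (structureConst b) (g.gram b) i j k • b k := by
  simp only [← repr_nabla]
  exact (b.sum_repr _).symm

theorem ricci_basis (g : InvMetric L) (b : Basis ι ℝ L) (i j : ι) :
    g.ricci (b i) (b j) = ricciCoord (structureConst b) (g.gram b) i j := by
  rw [ricci, LinearMap.trace_eq_matrix_trace ℝ b, Matrix.trace, ricciCoord]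
  refine Finset.sum_congr rfl fun m _ => ?_
  have hl : ⁅b m, b i⁆ = ∑ k, structureConst b m i k • b k := (b.sum_repr _).symm
  rw [Matrix.diag_apply, LinearMap.toMatrix_apply, curvature, LinearMap.coe_mk, AddHom.coe_mk,
    nabla_basis g b i j, nabla_basis g b m j, hl]
  simp only [map_sum, map_smul, LinearMap.sum_apply, LinearMap.smul_apply, map_sub,
    Finsupp.sub_apply, Finsupp.finsetSum_apply, Finsupp.smul_apply, smul_eq_mul, repr_nabla,
    Finset.sum_sub_distrib]

/-- The Ricci tensor as a bilinear form. -/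
noncomputable def ricciForm (g : InvMetric L) : LinearMap.BilinForm ℝ L :=
  LinearMap.mk₂ ℝ g.ricci
    (fun x x' y => by
      rw [ricci, ricci, ricci, ← map_add]; congr 1; ext z
      simp only [curvature, LinearMap.coe_mk, AddHom.coe_mk, LinearMap.add_apply, lie_add, map_add]
      abel)
    (fun c x y => by
      rw [ricci, ricci, ← map_smul]; congr 1; ext z
      simp only [curvature, LinearMap.coe_mk, AddHom.coe_mk, LinearMap.smul_apply, lie_smul,
        map_smul, smul_sub])
    (fun x y y' => by
      rw [ricci, ricci, ricci, ← map_add]; congr 1; ext z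
      simp only [curvature, LinearMap.coe_mk, AddHom.coe_mk, LinearMap.add_apply, map_add]
      abel)
    (fun c x y => by
      rw [ricci, ricci, ← map_smul]; congr 1; ext z
      simp only [curvature, LinearMap.coe_mk, AddHom.coe_mk, LinearMap.smul_apply, map_smul,
        smul_sub])

omit [Fintype ι] [DecidableEq ι] [FiniteDimensional ℝ L] in
theorem eq_of_gram_eq {g h : InvMetric L} (b : Basis ι ℝ L) (H : g.gram b = h.gram b) : g = h := by
  have : g.form = h.form := LinearMap.BilinForm.ext_basis b fun i j => congrFun (congrFun H i) j
  cases g; cases h; cases this; rfl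

end InvMetric

variable [FiniteDimensional ℝ L]

omit [DecidableEq ι] in
theorem isRicciFlow_of_basis (b : Basis ι ℝ L) {g : ℝ → InvMetric L}
    (h : ∀ t, 0 ≤ t → ∀ i j, HasDerivWithinAt (fun s => (g s).gram b i j)
      (-2 * (g t).ricci (b i) (b j)) (Ici 0) t) : IsRicciFlow g := by
  intro t ht x y
  have key : ∀ B : LinearMap.BilinForm ℝ L,
      B x y = ∑ i, ∑ j, b.repr x i * (b.repr y j * B (b i) (b j)) := by
    intro B
    conv_lhs => rw [← b.sum_repr x, ← b.sum_repr y]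
    simp only [map_sum, map_smul, LinearMap.sum_apply, LinearMap.smul_apply, smul_eq_mul,
      Finset.mul_sum]
    rw [Finset.sum_comm]
    exact Finset.sum_congr rfl fun i _ => Finset.sum_congr rfl fun j _ => by ring
  have hr : (g t).ricci x y =
      ∑ i, ∑ j, b.repr x i * (b.repr y j * (g t).ricci (b i) (b j)) := key (g t).ricciForm
  simp only [key, hr, Finset.mul_sum]
  refine HasDerivWithinAt.fun_sum fun i _ => HasDerivWithinAt.fun_sum fun j _ => ?_
  convert! ((h t ht i j).const_mul (b.repr y j)).const_mul (b.repr x i) using 1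
  ring

theorem IsRicciFlow.hasDerivWithinAt_gram (b : Basis ι ℝ L) {g : ℝ → InvMetric L}
    (hg : IsRicciFlow g) {t : ℝ} (ht : 0 ≤ t) :
    HasDerivWithinAt (fun s => (g s).gram b)
      (fun i j => -2 * ricciCoord (structureConst b) ((g t).gram b) i j) (Ici 0) t := by
  refine hasDerivWithinAt_pi.2 fun i => hasDerivWithinAt_pi.2 fun j => ?_
  rw [← InvMetric.ricci_basis]
  exact hg t ht (b i) (b j)

/-! ### Uniqueness of the Ricci flow -/

theorem contDiffAt_inv_entry (G : ι → ι → ℝ) (hG : (Matrix.of G).det ≠ 0) (k l : ι) :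
    ContDiffAt ℝ 1 (fun G : ι → ι → ℝ => (Matrix.of G)⁻¹ k l) G := by
  have hdet : ∀ F : (ι → ι → ℝ) → Matrix ι ι ℝ, (∀ i j, ContDiff ℝ 1 fun G => F G i j) →
      ContDiff ℝ 1 fun G => (F G).det := by
    intro F hF
    simp only [Matrix.det_apply']
    exact ContDiff.sum fun σ _ => contDiff_const.mul (contDiff_prod fun i _ => hF _ _)
  have hentry : ∀ i j : ι, ContDiff ℝ 1 fun G : ι → ι → ℝ => G i j := fun i j => by fun_prop
  simp only [Matrix.inv_def, Ring.inverse_eq_inv', Matrix.smul_apply, Matrix.adjugate_apply,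
    smul_eq_mul]
  refine ContDiffAt.mul (ContDiffAt.inv (hdet _ fun i j => hentry i j).contDiffAt hG) ?_
  refine (hdet _ fun i j => ?_).contDiffAt
  by_cases h : i = l
  · subst h
    simp only [Matrix.updateRow_self]
    exact contDiff_const
  · simp only [Matrix.updateRow_ne h]
    exact hentry i j

theorem contDiffAt_ricciCoord (c : ι → ι → ι → ℝ) (G : ι → ι → ℝ) (hG : (Matrix.of G).det ≠ 0) :
    ContDiffAt ℝ 1 (fun G : ι → ι → ℝ => fun i j => -2 * ricciCoord c G i j) G := by
  have hentry : ∀ i j : ι, ContDiffAt ℝ 1 (fun G : ι → ι → ℝ => G i j) G := fun i j => by fun_prop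
  have hs : ∀ (d : ι → ℝ) (j : ι), ContDiffAt ℝ 1 (fun G : ι → ι → ℝ => ∑ m, d m * G m j) G :=
    fun d j => ContDiffAt.sum fun m _ => contDiffAt_const.mul (hentry m j)
  have hΓ : ∀ i j k, ContDiffAt ℝ 1 (fun G : ι → ι → ℝ => christoffel c G i j k) G := by
    intro i j k
    simp only [christoffel]
    refine ContDiffAt.sum fun l _ => (contDiffAt_inv_entry G hG k l).mul
      (contDiffAt_const.mul (((hs _ _).sub (hs _ _)).add (hs (fun m => c l i m) _)))
  refine contDiffAt_pi.2 fun i => contDiffAt_pi.2 fun j => contDiffAt_const.mul ?_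
  simp only [ricciCoord]
  exact ContDiffAt.sum fun m _ => ContDiffAt.sum fun k _ =>
    (((hΓ _ _ _).mul (hΓ _ _ _)).sub ((hΓ _ _ _).mul (hΓ _ _ _))).sub
      (contDiffAt_const.mul (hΓ _ _ _))

/-- A Ricci flow of left-invariant metrics is determined by its initial metric. -/
theorem IsRicciFlow.eq_of_eq_zero (b : Basis ι ℝ L) {g h : ℝ → InvMetric L} (hg : IsRicciFlow g)
    (hh : IsRicciFlow h) (h0 : g 0 = h 0) {t : ℝ} (ht : 0 ≤ t) : g t = h t := by
  have hcont : ∀ {k : ℝ → InvMetric L}, IsRicciFlow k →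
      ContinuousOn (fun s => (k s).gram b) (Icc 0 t) := fun hk s hs =>
    (hk.hasDerivWithinAt_gram b hs.1).continuousWithinAt.mono Icc_subset_Ici_self
  set S : Set (ι → ι → ℝ) :=
    (fun s => (g s).gram b) '' Icc 0 t ∪ (fun s => (h s).gram b) '' Icc 0 t with hS
  have hcomp : IsCompact S :=
    (isCompact_Icc.image_of_continuousOn (hcont hg)).union
      (isCompact_Icc.image_of_continuousOn (hcont hh))
  have hdet : ∀ G ∈ S, (Matrix.of G).det ≠ 0 := by
    rintro G (⟨s, -, rfl⟩ | ⟨s, -, rfl⟩) <;> exact InvMetric.gram_det_ne_zero _ _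
  have hlip : LocallyLipschitzOn S
      (fun G : ι → ι → ℝ => fun i j => -2 * ricciCoord (structureConst b) G i j) := by
    intro G hG
    obtain ⟨K, u, hu, hK⟩ :=
      (contDiffAt_ricciCoord (structureConst b) G (hdet G hG)).exists_lipschitzOnWith
    exact ⟨K, u, mem_nhdsWithin_of_mem_nhds hu, hK⟩
  obtain ⟨K, hK⟩ := hlip.exists_lipschitzOnWith_of_compact hcomp
  have := ODE_solution_unique_of_mem_Icc_right (s := fun _ => S) (v := fun _ G i j =>
      -2 * ricciCoord (structureConst b) G i j) (fun _ _ => hK) (hcont hg)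
    (fun s hs => (hg.hasDerivWithinAt_gram b hs.1).mono (Ici_subset_Ici.2 hs.1))
    (fun s hs => Or.inl ⟨s, Ico_subset_Icc_self hs, rfl⟩) (hcont hh)
    (fun s hs => (hh.hasDerivWithinAt_gram b hs.1).mono (Ici_subset_Ici.2 hs.1))
    (fun s hs => Or.inr ⟨s, Ico_subset_Icc_self hs, rfl⟩) (by simp only [h0])
  exact InvMetric.eq_of_gram_eq b (this ⟨ht, le_rfl⟩)

end RicciCoordinates

/-! ### Diagonal metrics -/

section Diagonal

variable {ι : Type*} [Fintype ι] [DecidableEq ι] {L : Type*} [LieRing L] [LieAlgebra ℝ L]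

/-- The left-invariant metric that is diagonal in the basis `b` with diagonal entries `d`. -/
noncomputable def diagMetric (b : Basis ι ℝ L) (d : ι → ℝ) (hd : ∀ i, 0 < d i) : InvMetric L where
  form := Matrix.toBilin b (Matrix.diagonal d)
  symm x y := by
    simp only [Matrix.toBilin_apply, Matrix.diagonal_apply]
    simp [mul_left_comm, mul_comm]
  pos x hx := by
    have : Matrix.toBilin b (Matrix.diagonal d) x x = ∑ i, d i * b.repr x i ^ 2 := by
      simp only [Matrix.toBilin_apply, Matrix.diagonal_apply]
      simp only [mul_ite, ite_mul, mul_zero, zero_mul, Finset.sum_ite_eq, Finset.mem_univ, if_true]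
      exact Finset.sum_congr rfl fun i _ => by ring
    rw [this]
    refine Finset.sum_pos' (fun i _ => mul_nonneg (hd i).le (sq_nonneg _)) ?_
    by_contra! h
    refine hx (b.ext_elem fun i => ?_)
    have h1 := h i (Finset.mem_univ i)
    by_contra h2
    have h3 : b.repr x i ≠ 0 := by simpa using h2
    have := mul_pos (hd i) (by positivity : 0 < b.repr x i ^ 2)
    linarith

theorem diagMetric_gram (b : Basis ι ℝ L) (d : ι → ℝ) (hd : ∀ i, 0 < d i) (i j : ι) :
    (diagMetric b d hd).gram b i j = if i = j then d i else 0 := by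
  simp [InvMetric.gram, diagMetric, Matrix.toBilin_apply, Matrix.diagonal_apply,
    Finsupp.single_apply]
  split_ifs with h
  · rw [h]
  · rfl

/-- The Koszul formula in an orthogonal basis. -/
theorem christoffel_diagonal (c : ι → ι → ι → ℝ) {G : ι → ι → ℝ} {d : ι → ℝ} (hd : ∀ i, d i ≠ 0)
    (hG : ∀ i j, G i j = if i = j then d i else 0) (i j k : ι) :
    christoffel c G i j k =
      (d k)⁻¹ * (1 / 2 * (c i j k * d k - c j k i * d i + c k i j * d j)) := by
  have hinv : (Matrix.of G)⁻¹ = Matrix.diagonal fun i => (d i)⁻¹ := by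
    have h1 : Matrix.of G = Matrix.diagonal d := by
      ext i j
      rw [Matrix.of_apply, hG, Matrix.diagonal_apply]
    rw [h1]
    refine Matrix.inv_eq_left_inv ?_
    rw [Matrix.diagonal_mul_diagonal, ← Matrix.diagonal_one]
    congr 1
    ext i
    exact inv_mul_cancel₀ (hd i)
  rw [christoffel, hinv]
  simp only [hG, Matrix.diagonal_apply]
  simp

namespace InvMetric

variable [FiniteDimensional ℝ L]

/-- The square of the tensor norm in an orthogonal basis. -/
theorem trace_sharp_sharp_diagonal (g : InvMetric L) (b : Basis ι ℝ L) {d : ι → ℝ}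
    (hd : ∀ i, d i ≠ 0) (hg : ∀ i j, g.gram b i j = if i = j then d i else 0)
    (T : LinearMap.BilinForm ℝ L) :
    LinearMap.trace ℝ L ((g.sharp.toLinearMap ∘ₗ T.flip) ∘ₗ (g.sharp.toLinearMap ∘ₗ T)) =
      ∑ i, ∑ j, T (b i) (b j) ^ 2 / (d i * d j) := by
  have hsharp : ∀ φ : Dual ℝ L, g.sharp φ = ∑ j, (φ (b j) / d j) • b j := by
    intro φ
    rw [sharp_eq_iff g b]
    intro j
    rw [form_eq_sum, Finset.sum_eq_single j]
    · rw [b.repr_sum_self, hg, if_pos rfl, div_mul_cancel₀ _ (hd j)]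
    · intro m _ hm
      rw [hg, if_neg hm, mul_zero]
    · simp
  rw [LinearMap.trace_eq_matrix_trace ℝ b, Matrix.trace]
  refine Finset.sum_congr rfl fun i _ => ?_
  rw [Matrix.diag_apply, LinearMap.toMatrix_apply]
  simp only [LinearMap.comp_apply, LinearEquiv.coe_coe]
  rw [hsharp (T.flip _), b.repr_sum_self, LinearMap.BilinForm.flip_apply, hsharp (T (b i))]
  simp only [map_sum, map_smul, smul_eq_mul, Finset.sum_div]
  refine Finset.sum_congr rfl fun j _ => ?_
  have := hd i
  have := hd j
  field_simp

end InvMetric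

end Diagonal

/-! ### The Lie algebra U3I2 -/

section U3I2

variable {L : Type*} [LieRing L] [LieAlgebra ℝ L]

theorem IsU3I2Basis.structureConst_eq {X : Basis (Fin 4) ℝ L} (hX : IsU3I2Basis X)
    (i j k : Fin 4) : structureConst X i j k =
      (![![0, ![0, 0, 1, 0], ![0, -1, 0, 0], 0], ![![0, 0, -1, 0], 0, ![0, 0, 0, -1], 0],
        ![![0, 1, 0, 0], ![0, 0, 0, 1], 0, 0], 0] : Fin 4 → Fin 4 → Fin 4 → ℝ) i j k := by
  have h21 : ⁅X 1, X 0⁆ = -X 2 := by rw [← lie_skew, hX.lie_12]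
  have h13 : ⁅X 0, X 2⁆ = -X 1 := by rw [← lie_skew, hX.lie_31]
  have h32 : ⁅X 2, X 1⁆ = X 3 := by rw [← lie_skew, hX.lie_23, neg_neg]
  have h4 : ∀ i, ⁅X i, X 3⁆ = 0 := fun i => by rw [← lie_skew, hX.lie_4, neg_zero]
  fin_cases i <;> fin_cases j <;> fin_cases k <;>
    simp [structureConst, h21, h13, h32, h4, hX.lie_12, hX.lie_31, hX.lie_23, hX.lie_4]

/-- In a `U3I2` basis, diagonal metrics have diagonal Ricci tensor; the right-hand side is that of
the Ricci flow equation. -/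
theorem IsU3I2Basis.ricci_diagonal [FiniteDimensional ℝ L] {X : Basis (Fin 4) ℝ L}
    (hX : IsU3I2Basis X) (g : InvMetric L)
    {d : Fin 4 → ℝ} (hd : ∀ i, d i ≠ 0) (hg : ∀ i j, g.gram X i j = if i = j then d i else 0)
    (i j : Fin 4) :
    -2 * g.ricci (X i) (X j) = if i = j then
      ![(d 1 - d 2) ^ 2 / (d 1 * d 2), (d 2 ^ 2 - d 1 ^ 2) / (d 0 * d 2) + d 3 / d 2,
        (d 1 ^ 2 - d 2 ^ 2) / (d 0 * d 1) + d 3 / d 1, -(d 3 ^ 2 / (d 1 * d 2))] i else 0 := by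
  have h0 := hd 0
  have h1 := hd 1
  have h2 := hd 2
  have h3 := hd 3
  rw [InvMetric.ricci_basis, ricciCoord]
  simp only [christoffel_diagonal _ hd hg, hX.structureConst_eq, Fin.sum_univ_four]
  fin_cases i <;> fin_cases j <;> simp <;> field_simp <;> ring

/-- The frame `Y` is again a basis with the bracket relations of `U3I2`: the matrix `Λ` is the
matrix of an automorphism. -/
theorem IsU3I2Basis.exists_frame {X : Basis (Fin 4) ℝ L} (hX : IsU3I2Basis X) (a₁ a₃ a₆ : ℝ) :
    ∃ Y : Basis (Fin 4) ℝ L, ⇑Y = frame X a₁ a₃ a₆ ∧ IsU3I2Basis Y := by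
  have h32 : ⁅X 2, X 1⁆ = X 3 := by rw [← lie_skew, hX.lie_23, neg_neg]
  have h4 : ∀ i, ⁅X i, X 3⁆ = 0 := fun i => by rw [← lie_skew, hX.lie_4, neg_zero]
  have hli : LinearIndependent ℝ (frame X a₁ a₃ a₆) := by
    rw [Fintype.linearIndependent_iff]
    intro c hc
    have hk : ∀ k, X.repr (∑ i, c i • frame X a₁ a₃ a₆ i) k = 0 := fun k => by rw [hc]; simp
    have e0 := hk 0
    have e1 := hk 1
    have e2 := hk 2
    have e3 := hk 3
    simp [frame, frameMatrix, Fin.sum_univ_four] at e0 e1 e2 e3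
    simp [e0] at e1 e2 e3
    simp [e1, e2] at e3
    intro i
    fin_cases i <;> assumption
  refine ⟨basisOfLinearIndependentOfCardEqFinrank hli (by simp [finrank_eq_card_basis X]), by simp,
    ?_⟩
  constructor
  · simp [frame, frameMatrix, Fin.sum_univ_four, h32, h4, hX.lie_12, hX.lie_4]
  · simp [frame, frameMatrix, Fin.sum_univ_four, h32, h4, hX.lie_31, hX.lie_4]
  · simp [frame, frameMatrix, Fin.sum_univ_four, h4, hX.lie_23, hX.lie_4]
  · intro i
    fin_cases i <;> simp [frame, frameMatrix, Fin.sum_univ_four, hX.lie_4]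

end U3I2

/-! ### The explicit diagonal Ricci flows -/

section ExplicitFlow

open Filter Topology

theorem hasDerivAt_sub_tanh (x : ℝ) :
    HasDerivAt (fun x => x - Real.tanh x) (Real.tanh x ^ 2) x := by
  have hc := (Real.cosh_pos x).ne'
  have h := (hasDerivAt_id x).sub ((Real.hasDerivAt_sinh x).div (Real.hasDerivAt_cosh x) hc)
  have he : (fun x => x - Real.tanh x) = id - Real.sinh / Real.cosh := by
    ext y
    simp [Real.tanh_eq_sinh_div_cosh]
  rw [he, Real.tanh_eq_sinh_div_cosh]
  convert! h using 1
  field_simp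
  ring

theorem strictMono_sub_tanh : StrictMono fun x => x - Real.tanh x := by
  refine strictMono_of_odd_strictMonoOn_nonneg (fun x => by simp only [Real.tanh_neg]; ring) ?_
  refine strictMonoOn_of_deriv_pos (convex_Ici 0)
    (fun x _ => (hasDerivAt_sub_tanh x).continuousAt.continuousWithinAt) fun x hx => ?_
  rw [interior_Ici, mem_Ioi] at hx
  rw [(hasDerivAt_sub_tanh x).deriv, Real.tanh_eq_sinh_div_cosh]
  have := Real.sinh_pos_iff.2 hx
  have := Real.cosh_pos x
  positivity

theorem surjective_sub_tanh : Function.Surjective fun x => x - Real.tanh x := by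
  refine Continuous.surjective
    (continuous_iff_continuousAt.2 fun x => (hasDerivAt_sub_tanh x).continuousAt) ?_ ?_
  · refine tendsto_atTop_mono (fun x => ?_) (tendsto_atTop_add_const_right atTop (-1) tendsto_id)
    simp only [id]
    linarith [Real.tanh_lt_one x]
  · refine tendsto_atBot_mono (fun x => ?_) (tendsto_atBot_add_const_right atBot 1 tendsto_id)
    simp only [id]
    linarith [Real.neg_one_lt_tanh x]

/-- The equation `x' = k / tanh² x` is solved by inverting `x - tanh x = k t + const`. -/
theorem exists_deriv_eq_div_tanh_sq {k x₀ : ℝ} (hk : 0 < k) (hx₀ : 0 < x₀) :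
    ∃ x : ℝ → ℝ, x 0 = x₀ ∧
      (∀ t, 0 ≤ t → 0 < x t ∧ HasDerivAt x (k / Real.tanh (x t) ^ 2) t) ∧
      Tendsto x atTop atTop := by
  set e := strictMono_sub_tanh.orderIsoOfSurjective _ surjective_sub_tanh with he
  have hφ : ∀ x, e x = x - Real.tanh x := fun x => rfl
  have hφx₀ : 0 < e x₀ := by
    have := strictMono_sub_tanh hx₀
    simpa [hφ] using this
  have hinv : ∀ y, e.symm y - Real.tanh (e.symm y) = y := fun y => e.apply_symm_apply y
  refine ⟨fun t => e.symm (k * t + e x₀), by simp, fun t ht => ?_, ?_⟩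
  · have hpos : 0 < e.symm (k * t + e x₀) := by
      rw [e.lt_symm_apply, hφ]
      have : 0 ≤ k * t := by positivity
      simp only [Real.tanh_zero, sub_zero]
      linarith
    refine ⟨hpos, ?_⟩
    have hne : Real.tanh (e.symm (k * t + e x₀)) ^ 2 ≠ 0 := by
      rw [Real.tanh_eq_sinh_div_cosh]
      have := Real.sinh_pos_iff.2 hpos
      have := Real.cosh_pos (e.symm (k * t + e x₀))
      positivity
    have h := HasDerivAt.of_local_left_inverse (g := e.symm) (a := k * t + e x₀)
      e.symm.continuous.continuousAt (hasDerivAt_sub_tanh _) hne (Eventually.of_forall hinv)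
    have h2 : HasDerivAt (fun t => k * t + e x₀) k t := by
      simpa using ((hasDerivAt_id t).const_mul k).add_const (e x₀)
    convert! h.comp t h2 using 1
    rw [div_eq_inv_mul]
  · refine tendsto_atTop_mono (f := fun t => k * t + (e x₀ - 1)) (fun t => ?_)
      (tendsto_atTop_add_const_right _ _ (tendsto_id.const_mul_atTop hk))
    have := hinv (k * t + e x₀)
    linarith [Real.neg_one_lt_tanh (e.symm (k * t + e x₀))]

/-- The equation for `q = (√B - √C) / (√B + √C)` along a diagonal flow `diag(A, B, C, D)`.  It is
solved by `q = ± exp (-x)` with `x` from `exists_deriv_eq_div_tanh_sq`, unless `q = 0`. -/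
theorem exists_ratio_solution {k q₀ : ℝ} (hk : 0 < k) (hq₀ : |q₀| < 1) :
    ∃ q : ℝ → ℝ, q 0 = q₀ ∧
      (∀ t, 0 ≤ t → |q t| < 1 ∧
        HasDerivAt q (-(k * q t * (1 + q t ^ 2) ^ 2 / (1 - q t ^ 2) ^ 2)) t) ∧
      Tendsto q atTop (𝓝 0) := by
  rcases eq_or_ne q₀ 0 with rfl | hq
  · refine ⟨fun _ => 0, rfl, fun t _ => ⟨by simp, ?_⟩, tendsto_const_nhds⟩
    simpa using hasDerivAt_const t (0 : ℝ)
  have habs : 0 < |q₀| := abs_pos.2 hq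
  obtain ⟨x, hx0, hx, hxt⟩ := exists_deriv_eq_div_tanh_sq hk
    (neg_pos.2 (Real.log_neg habs hq₀))
  have hσ : (q₀ / |q₀|) ^ 2 = 1 := by rw [div_pow, sq_abs, div_self (by positivity)]
  have hσabs : abs (q₀ / abs q₀) = 1 := by rw [abs_div, abs_abs, div_self habs.ne']
  refine ⟨fun t => q₀ / |q₀| * Real.exp (-x t), ?_, fun t ht => ⟨?_, ?_⟩, ?_⟩
  · simp only [hx0, neg_neg, Real.exp_log habs, div_mul_cancel₀ _ habs.ne']
  · rw [abs_mul, hσabs, one_mul, Real.abs_exp, Real.exp_lt_one_iff]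
    linarith [(hx t ht).1]
  · have h := (((hx t ht).2.neg).exp).const_mul (q₀ / |q₀|)
    convert! h using 1
    have hE : Real.exp (-x t) < 1 := by
      rw [Real.exp_lt_one_iff]
      linarith [(hx t ht).1]
    have hE0 := Real.exp_pos (-x t)
    have h1 : 1 - Real.exp (-x t) ^ 2 ≠ 0 := by nlinarith
    have h2 : 1 + Real.exp (-x t) ^ 2 ≠ 0 := by positivity
    have ht : Real.tanh (x t) = (1 - Real.exp (-x t) ^ 2) / (1 + Real.exp (-x t) ^ 2) := by
      have : Real.exp (x t) = (Real.exp (-x t))⁻¹ := by rw [Real.exp_neg, inv_inv]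
      rw [Real.tanh_eq, this]
      field_simp
    simp only [Pi.neg_apply, ht, mul_pow, hσ]
    field_simp
  · have h := (Real.tendsto_exp_neg_atTop_nhds_zero.comp hxt).const_mul (q₀ / |q₀|)
    simpa using h

variable {L : Type*} [LieRing L] [LieAlgebra ℝ L] [FiniteDimensional ℝ L]

/-- The Ricci flow equation for diagonal metrics `diag(A, B, C, D)` in a `U3I2` basis. -/
theorem IsU3I2Basis.isRicciFlow_diagMetric {Y : Basis (Fin 4) ℝ L} (hY : IsU3I2Basis Y)
    {d : ℝ → Fin 4 → ℝ} (hd : ∀ t i, 0 < d t i)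
    (h : ∀ t, 0 ≤ t → ∀ i, HasDerivWithinAt (fun s => d s i)
      (![(d t 1 - d t 2) ^ 2 / (d t 1 * d t 2),
        (d t 2 ^ 2 - d t 1 ^ 2) / (d t 0 * d t 2) + d t 3 / d t 2,
        (d t 1 ^ 2 - d t 2 ^ 2) / (d t 0 * d t 1) + d t 3 / d t 1,
        -(d t 3 ^ 2 / (d t 1 * d t 2))] i) (Ici 0) t) :
    IsRicciFlow fun t => diagMetric Y (d t) (hd t) := by
  refine isRicciFlow_of_basis Y fun t ht i j => ?_
  rw [hY.ricci_diagonal _ (fun i => (hd t i).ne') (diagMetric_gram Y (d t) (hd t))]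
  simp only [diagMetric_gram]
  split_ifs with hij
  · exact h t ht i
  · exact hasDerivWithinAt_const _ _ _

/-- The behaviour at infinity of a flow of metrics `diag(A, B, C, D)` with the conserved quantities
`K² = B C D²` and `M = A D (B + C)`, namely `A → M / (2K)`, `B, C ~ (3 K t)^{1/3}` and
`D ~ K (3 K t)^{-1/3}`. -/
structure DiagonalAsymptotics (d : ℝ → Fin 4 → ℝ) (K M : ℝ) : Prop where
  tendsto_0 : Tendsto (fun t => d t 0) atTop (𝓝 (M / (2 * K)))
  tendsto_1 : Tendsto (fun t => d t 1 / t ^ (1 / 3 : ℝ)) atTop (𝓝 ((3 * K) ^ (1 / 3 : ℝ)))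
  tendsto_2 : Tendsto (fun t => d t 2 / t ^ (1 / 3 : ℝ)) atTop (𝓝 ((3 * K) ^ (1 / 3 : ℝ)))
  tendsto_3 : Tendsto (fun t => d t 3 * t ^ (1 / 3 : ℝ)) atTop (𝓝 (K / (3 * K) ^ (1 / 3 : ℝ)))

/-- Every diagonal metric is the initial metric of a Ricci flow of diagonal metrics on `[0, ∞)`. -/
theorem IsU3I2Basis.exists_diagonal_flow {Y : Basis (Fin 4) ℝ L} (hY : IsU3I2Basis Y)
    {lam : Fin 4 → ℝ} (hlam : ∀ i, 0 < lam i) {K M : ℝ}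
    (hK : K = Real.sqrt (lam 1 * lam 2) * lam 3) (hM : M = lam 0 * lam 3 * (lam 1 + lam 2)) :
    ∃ (d : ℝ → Fin 4 → ℝ) (hd : ∀ t i, 0 < d t i), d 0 = lam ∧
      IsRicciFlow (fun t => diagMetric Y (d t) (hd t)) ∧ DiagonalAsymptotics d K M := by
  have l0 := hlam 0
  have l1 := hlam 1
  have l2 := hlam 2
  have l3 := hlam 3
  obtain ⟨β, hβ, hβ2⟩ : ∃ β : ℝ, 0 < β ∧ β ^ 2 = lam 1 :=
    ⟨_, Real.sqrt_pos.2 l1, Real.sq_sqrt l1.le⟩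
  obtain ⟨γ, hγ, hγ2⟩ : ∃ γ : ℝ, 0 < γ ∧ γ ^ 2 = lam 2 :=
    ⟨_, Real.sqrt_pos.2 l2, Real.sq_sqrt l2.le⟩
  have hKβ : K = β * γ * lam 3 := by
    rw [hK, ← hβ2, ← hγ2, ← mul_pow, Real.sqrt_sq (by positivity)]
  have hKpos : 0 < K := by rw [hKβ]; positivity
  have hMpos : 0 < M := by rw [hM]; positivity
  have hq₀ : |(β - γ) / (β + γ)| < 1 := by
    rw [abs_lt, lt_div_iff₀ (by positivity), div_lt_iff₀ (by positivity)]
    constructor <;> linarith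
  -- `N = A (B + C) / √(B C)`, twice the limit of `A`; the equation for `q` has `k = 8 / N`.
  obtain ⟨N, hN, hNpos⟩ : ∃ N : ℝ, N = M / K ∧ 0 < N := ⟨_, rfl, by positivity⟩
  obtain ⟨q, hq0, hq, hqt⟩ := exists_ratio_solution (k := 8 / N) (by positivity) hq₀
  -- `S = √(B C)` satisfies `S' = K / S²`.
  obtain ⟨S, hS⟩ : ∃ S : ℝ → ℝ, S = fun t => (3 * K * t + (β * γ) ^ 3) ^ (1 / 3 : ℝ) := ⟨_, rfl⟩
  have hbase : ∀ t, 0 ≤ t → 0 < 3 * K * t + (β * γ) ^ 3 := fun t ht => by positivity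
  have hSpos : ∀ t, 0 ≤ t → 0 < S t := fun t ht => by
    rw [hS]
    exact Real.rpow_pos_of_pos (hbase t ht) _
  have hS0 : S 0 = β * γ := by
    rw [hS]
    simp only [mul_zero, zero_add]
    rw [← Real.rpow_natCast, ← Real.rpow_mul (by positivity)]
    norm_num
  have hSd : ∀ t, 0 ≤ t → HasDerivAt S (K / S t ^ 2) t := fun t ht => by
    have h1 : HasDerivAt (fun t => 3 * K * t + (β * γ) ^ 3) (3 * K) t := by
      simpa using ((hasDerivAt_id t).const_mul (3 * K)).add_const ((β * γ) ^ 3)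
    have h2 := h1.rpow_const (p := 1 / 3) (Or.inl (hbase t ht).ne')
    rw [hS]
    convert! h2 using 1
    rw [show 3 * K * (1 / 3) = K by ring, ← Real.rpow_natCast,
      ← Real.rpow_mul (hbase t ht).le, div_eq_mul_inv,
      ← Real.rpow_neg (hbase t ht).le]
    norm_num
  have hSt : Tendsto (fun t => S t / t ^ (1 / 3 : ℝ)) atTop (𝓝 ((3 * K) ^ (1 / 3 : ℝ))) := by
    have h1 : Tendsto (fun t : ℝ => 3 * K + (β * γ) ^ 3 / t) atTop (𝓝 (3 * K)) := by
      simpa using (tendsto_const_nhds (x := 3 * K)).add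
        (tendsto_const_nhds (x := (β * γ) ^ 3).div_atTop tendsto_id)
    refine (h1.rpow_const (p := 1 / 3) (Or.inl (by positivity))).congr' ?_
    filter_upwards [eventually_gt_atTop 0] with t ht
    rw [hS, ← Real.div_rpow (hbase t ht.le).le ht.le]
    congr 1
    field_simp
  -- The solution for `t ≥ 0`; it is extended by its initial value to `t < 0`, where the entries of
  -- `e t` need not be positive.
  obtain ⟨e, he⟩ : ∃ e : ℝ → Fin 4 → ℝ, e = fun t =>
      ![N / 2 * ((1 - q t ^ 2) / (1 + q t ^ 2)), S t * ((1 + q t) / (1 - q t)),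
        S t * ((1 - q t) / (1 + q t)), K / S t] := ⟨_, rfl⟩
  have hepos : ∀ t, 0 ≤ t → ∀ i, 0 < e t i := fun t ht i => by
    have h1 := abs_lt.1 (hq t ht).1
    have h2 : 0 < 1 - q t ^ 2 := by nlinarith
    have h3 : 0 < 1 + q t := by linarith
    have h4 : 0 < 1 - q t := by linarith
    have h5 := hSpos t ht
    rw [he]
    fin_cases i <;> simp <;> positivity
  have hmax : ∀ t, 0 ≤ t → e (max t 0) = e t := fun t ht => by rw [max_eq_left ht]
  have hev : ∀ i, (fun t => e t i) =ᶠ[atTop] fun t => e (max t 0) i := fun i => by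
    filter_upwards [eventually_ge_atTop 0] with t ht
    rw [hmax t ht]
  refine ⟨fun t => e (max t 0), fun t => hepos _ (le_max_right _ _), ?_, ?_, ⟨?_, ?_, ?_, ?_⟩⟩
  · simp only [max_self, he, hq0, hS0, hN]
    ext i
    rw [hKβ, hM, ← hβ2, ← hγ2]
    fin_cases i
    · simp
      field_simp
      ring
    · have : (1 + (β - γ) / (β + γ)) / (1 - (β - γ) / (β + γ)) = β / γ := by
        rw [div_eq_div_iff (by field_simp; ring_nf; positivity) hγ.ne']
        field_simp
        ring
      simp [← hβ2, this]
      field_simp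
    · have : (1 - (β - γ) / (β + γ)) / (1 + (β - γ) / (β + γ)) = γ / β := by
        rw [div_eq_div_iff (by field_simp; ring_nf; positivity) hβ.ne']
        field_simp
        ring
      simp [← hγ2, this]
      field_simp
    · simp
      field_simp
  · refine hY.isRicciFlow_diagMetric (d := fun t => e (max t 0))
      (fun t => hepos _ (le_max_right _ _)) fun t ht i => ?_
    refine HasDerivWithinAt.congr (f := fun s => e s i) ?_ (fun s hs => by rw [hmax s hs])
      (by rw [hmax t ht])
    refine HasDerivAt.hasDerivWithinAt ?_
    have h1 := abs_lt.1 (hq t ht).1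
    have h2 : 0 < 1 - q t ^ 2 := by nlinarith
    have h3 : 0 < 1 + q t := by linarith
    have h4 : 0 < 1 - q t := by linarith
    have h5 := hSpos t ht
    have h6 : 1 + q t ^ 2 ≠ 0 := by positivity
    have hqd := (hq t ht).2
    have hsd := hSd t ht
    have hq2 := hqd.fun_pow 2
    simp only [max_eq_left ht, he]
    fin_cases i
    · have h := ((hq2.const_sub 1).fun_div (hq2.const_add 1) h6).const_mul (N / 2)
      simp
      convert! h using 1
      field_simp
      ring
    · have h := hsd.fun_mul ((hqd.const_add 1).fun_div (hqd.const_sub 1) h4.ne')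
      simp
      convert! h using 1
      have e1 : 1 - q t ^ 2 = (1 - q t) * (1 + q t) := by ring
      rw [e1]
      field_simp
      ring
    · have h := hsd.fun_mul ((hqd.const_sub 1).fun_div (hqd.const_add 1) h3.ne')
      simp
      convert! h using 1
      have e1 : 1 - q t ^ 2 = (1 - q t) * (1 + q t) := by ring
      rw [e1]
      field_simp
      ring
    · have h := (hasDerivAt_const t K).fun_div hsd h5.ne'
      simp
      convert! h using 1
      field_simp
      ring
  · refine Tendsto.congr' (hev 0) ?_
    have h := ((hqt.pow 2).const_sub 1).div ((hqt.pow 2).const_add 1) (by norm_num)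
    have h' := h.const_mul (N / 2)
    have hl : M / (2 * K) = N / 2 * ((1 - 0 ^ 2) / (1 + 0 ^ 2)) := by
      rw [hN]
      field_simp
      norm_num
    rw [hl, he]
    exact h'
  · refine Tendsto.congr' ((hev 1).div (EventuallyEq.refl _ _)) ?_
    have h := hSt.mul ((hqt.const_add 1).div (hqt.const_sub 1) (by norm_num))
    simp only [add_zero, sub_zero, div_one, mul_one] at h
    refine h.congr fun t => ?_
    simp [he]
    ring
  · refine Tendsto.congr' ((hev 2).div (EventuallyEq.refl _ _)) ?_
    have h := hSt.mul ((hqt.const_sub 1).div (hqt.const_add 1) (by norm_num))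
    simp only [add_zero, sub_zero, div_one, mul_one] at h
    refine h.congr fun t => ?_
    simp [he]
    ring
  · refine Tendsto.congr' ((hev 3).mul (EventuallyEq.refl _ _)) ?_
    have h := (tendsto_const_nhds (x := K)).div hSt (by positivity)
    refine h.congr fun t => ?_
    simp [he]
    rw [div_div_eq_mul_div]
    ring

end ExplicitFlow

/-! ### Quasi-convergence in terms of components -/

section QuasiConvergence

open Filter Topology

variable {L : Type*} [LieRing L] [LieAlgebra ℝ L] [FiniteDimensional ℝ L]

theorem quasiConverges_iff_tendsto {g h : ℝ → InvMetric L} :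
    QuasiConverges g h ↔
      Tendsto (fun t => (h t).tensorNorm ((g t).form - (h t).form)) atTop (𝓝 0) := by
  have hnn : ∀ t, 0 ≤ (h t).tensorNorm ((g t).form - (h t).form) := fun t => Real.sqrt_nonneg _
  constructor
  · intro H
    rw [Metric.tendsto_atTop]
    intro ε hε
    obtain ⟨T, -, hT⟩ := H ε hε
    refine ⟨T, fun t ht => ?_⟩
    rw [Real.dist_eq, sub_zero, abs_of_nonneg (hnn t), ← ENNReal.ofReal_lt_ofReal_iff hε]
    exact lt_of_le_of_lt (le_iSup₂_of_le t ht le_rfl) hT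
  · intro H ε hε
    obtain ⟨T, hT⟩ := Metric.tendsto_atTop.1 H (ε / 2) (half_pos hε)
    refine ⟨max T 0, le_max_right _ _, lt_of_le_of_lt (iSup₂_le (a := ENNReal.ofReal (ε / 2))
      fun t ht => ENNReal.ofReal_le_ofReal ?_) ?_⟩
    · have := hT t (le_trans (le_max_left _ _) ht)
      rw [Real.dist_eq, sub_zero, abs_of_nonneg (hnn t)] at this
      exact this.le
    · exact (ENNReal.ofReal_lt_ofReal_iff hε).2 (half_lt_self hε)

/-- With respect to diagonal metrics `diag(d i)`, quasi-convergence means that the components of the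
difference in the normalized frame tend to `0`. -/
theorem quasiConverges_iff_components {ι : Type*} [Fintype ι] [DecidableEq ι] (b : Basis ι ℝ L)
    {g h : ℝ → InvMetric L} {d : ℝ → ι → ℝ} (hd : ∀ t i, 0 < d t i)
    (hh : ∀ t, 0 ≤ t → h t = diagMetric b (d t) (hd t)) :
    QuasiConverges g h ↔ ∀ i j, Tendsto (fun t =>
      ((g t).gram b i j - if i = j then d t i else 0) ^ 2 / (d t i * d t j)) atTop (𝓝 0) := by
  have hnorm : (fun t => (h t).tensorNorm ((g t).form - (h t).form)) =ᶠ[atTop] fun t =>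
      Real.sqrt (∑ i, ∑ j,
        ((g t).gram b i j - if i = j then d t i else 0) ^ 2 / (d t i * d t j)) := by
    filter_upwards [eventually_ge_atTop 0] with t ht
    have hgram : ∀ i j, (h t).gram b i j = if i = j then d t i else 0 := by
      rw [hh t ht]
      exact diagMetric_gram b (d t) (hd t)
    rw [InvMetric.tensorNorm, InvMetric.trace_sharp_sharp_diagonal _ b (fun i => (hd t i).ne') hgram]
    simp only [← hgram]
    rfl
  have hterm : ∀ t i j,
      0 ≤ ((g t).gram b i j - if i = j then d t i else 0) ^ 2 / (d t i * d t j) :=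
    fun t i j => div_nonneg (sq_nonneg _) (mul_pos (hd t i) (hd t j)).le
  have hsum : ∀ t, 0 ≤ ∑ i, ∑ j,
      ((g t).gram b i j - if i = j then d t i else 0) ^ 2 / (d t i * d t j) :=
    fun t => Finset.sum_nonneg fun i _ => Finset.sum_nonneg fun j _ => hterm t i j
  rw [quasiConverges_iff_tendsto, tendsto_congr' hnorm]
  constructor
  · intro H i j
    have H2 := H.pow 2
    simp only [Real.sq_sqrt (hsum _), ne_eq, OfNat.ofNat_ne_zero, not_false_eq_true,
      zero_pow] at H2
    refine squeeze_zero (fun t => hterm t i j) (fun t => ?_) H2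
    refine le_trans ?_ (Finset.single_le_sum (f := fun i => ∑ j,
      ((g t).gram b i j - if i = j then d t i else 0) ^ 2 / (d t i * d t j))
      (fun i _ => Finset.sum_nonneg fun j _ => hterm t i j) (Finset.mem_univ i))
    exact Finset.single_le_sum (f := fun j =>
      ((g t).gram b i j - if i = j then d t i else 0) ^ 2 / (d t i * d t j))
      (fun j _ => hterm t i j) (Finset.mem_univ j)
  · intro H
    have H2 := (tendsto_finsetSum Finset.univ fun i _ =>
      tendsto_finsetSum Finset.univ fun j _ => H i j).sqrt
    simpa using H2

/-- The Gram matrix of `diag(d 0, …, d 3)` in the frame with the rows `(1, a, b, e)`, `(0, 1, 0, a)`,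
`(0, 0, 1, b)`, `(0, 0, 0, 1)`. -/
def frameGram (a b e : ℝ) (d : Fin 4 → ℝ) : Matrix (Fin 4) (Fin 4) ℝ :=
  !![d 0 + a ^ 2 * d 1 + b ^ 2 * d 2 + e ^ 2 * d 3, a * d 1 + e * a * d 3,
      b * d 2 + e * b * d 3, e * d 3;
    a * d 1 + e * a * d 3, d 1 + a ^ 2 * d 3, a * b * d 3, a * d 3;
    b * d 2 + e * b * d 3, a * b * d 3, d 2 + b ^ 2 * d 3, b * d 3;
    e * d 3, a * d 3, b * d 3, d 3]

omit [FiniteDimensional ℝ L] in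
/-- The components in the frame `Y(a₁, a₃, a₆)` of a metric that is diagonal in the frame
`Y(b₁, b₃, b₆)`. -/
theorem gram_frame_diagMetric (X Y Y' : Basis (Fin 4) ℝ L) {a₁ a₃ a₆ b₁ b₃ b₆ : ℝ}
    (hY : ⇑Y = frame X a₁ a₃ a₆) (hY' : ⇑Y' = frame X b₁ b₃ b₆) (d : Fin 4 → ℝ)
    (hd : ∀ i, 0 < d i) {a b e : ℝ} (ha : a = a₃ - b₃) (hb : b = a₁ - b₁)
    (he : e = a₆ - b₆ - a * b₃ - b * b₁) (i j : Fin 4) :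
    (diagMetric Y' d hd).gram Y i j =
      frameGram a b e d i j := by
  have hform : ∀ i j, (diagMetric Y' d hd).form (Y' i) (Y' j) = if i = j then d i else 0 :=
    diagMetric_gram Y' d hd
  have h0 : Y 0 = Y' 0 + a • Y' 1 + b • Y' 2 + e • Y' 3 := by
    rw [hY, hY', he, ha, hb]
    simp [frame, frameMatrix, Fin.sum_univ_four]
    module
  have h1 : Y 1 = Y' 1 + a • Y' 3 := by
    rw [hY, hY', ha]
    simp [frame, frameMatrix, Fin.sum_univ_four]
    module
  have h2 : Y 2 = Y' 2 + b • Y' 3 := by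
    rw [hY, hY', hb]
    simp [frame, frameMatrix, Fin.sum_univ_four]
    module
  have h3 : Y 3 = Y' 3 := by
    rw [hY, hY']
    simp [frame, frameMatrix, Fin.sum_univ_four]
  rw [InvMetric.gram]
  fin_cases i <;> fin_cases j <;> simp [frameGram, h0, h1, h2, h3, hform] <;> ring

end QuasiConvergence

/-! ### Comparison of the asymptotics -/

section Asymptotics

open Filter Topology

namespace DiagonalAsymptotics

variable {d d' : ℝ → Fin 4 → ℝ} {K K' M M' : ℝ}

theorem tendsto_3_zero (h : DiagonalAsymptotics d K M) :
    Tendsto (fun t => d t 3) atTop (𝓝 0) := by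
  refine (h.tendsto_3.div_atTop (tendsto_rpow_atTop (by norm_num : (0 : ℝ) < 1 / 3))).congr' ?_
  filter_upwards [eventually_gt_atTop 0] with t ht
  have := Real.rpow_pos_of_pos ht (1 / 3)
  field_simp

theorem tendsto_div_1 (h : DiagonalAsymptotics d K M) (h' : DiagonalAsymptotics d' K' M')
    (hK : 0 < K) : Tendsto (fun t => d' t 1 / d t 1) atTop
      (𝓝 ((3 * K') ^ (1 / 3 : ℝ) / (3 * K) ^ (1 / 3 : ℝ))) := by
  refine (h'.tendsto_1.div h.tendsto_1 (by positivity)).congr' ?_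
  filter_upwards [eventually_gt_atTop 0] with t ht
  exact div_div_div_cancel_right₀ (Real.rpow_pos_of_pos ht (1 / 3)).ne' _ _

theorem tendsto_div_2 (h : DiagonalAsymptotics d K M) (h' : DiagonalAsymptotics d' K' M')
    (hK : 0 < K) : Tendsto (fun t => d' t 2 / d t 2) atTop
      (𝓝 ((3 * K') ^ (1 / 3 : ℝ) / (3 * K) ^ (1 / 3 : ℝ))) := by
  refine (h'.tendsto_2.div h.tendsto_2 (by positivity)).congr' ?_
  filter_upwards [eventually_gt_atTop 0] with t ht
  exact div_div_div_cancel_right₀ (Real.rpow_pos_of_pos ht (1 / 3)).ne' _ _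

theorem tendsto_div_3 (h : DiagonalAsymptotics d K M) (h' : DiagonalAsymptotics d' K M')
    (hK : 0 < K) : Tendsto (fun t => d' t 3 / d t 3) atTop (𝓝 1) := by
  have h1 := h'.tendsto_3.div h.tendsto_3 (by positivity)
  rw [div_self (by positivity)] at h1
  refine h1.congr' ?_
  filter_upwards [eventually_gt_atTop 0] with t ht
  exact mul_div_mul_right _ _ (Real.rpow_pos_of_pos ht (1 / 3)).ne'

end DiagonalAsymptotics

theorem tendsto_zero_of_sq {f : ℝ → ℝ} {l : Filter ℝ} (h : Tendsto (fun t => f t ^ 2) l (𝓝 0)) :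
    Tendsto f l (𝓝 0) := by
  rw [tendsto_zero_iff_abs_tendsto_zero]
  have := h.sqrt
  simpa only [Real.sqrt_sq_eq_abs, Real.sqrt_zero, Function.comp_def] using this

variable {L : Type*} [LieRing L] [LieAlgebra ℝ L] [FiniteDimensional ℝ L]

/-- Quasi-convergence of two diagonal flows in terms of the differences of the frame parameters and
of the conserved quantities. -/
theorem quasiConverges_diagonal_iff (X Y Y' : Basis (Fin 4) ℝ L) {a₁ a₃ a₆ b₁ b₃ b₆ : ℝ}
    (hY : ⇑Y = frame X a₁ a₃ a₆) (hY' : ⇑Y' = frame X b₁ b₃ b₆) {d d' : ℝ → Fin 4 → ℝ}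
    (hd : ∀ t i, 0 < d t i) (hd' : ∀ t i, 0 < d' t i) {g g' : ℝ → InvMetric L}
    (hg : ∀ t, 0 ≤ t → g t = diagMetric Y (d t) (hd t))
    (hg' : ∀ t, 0 ≤ t → g' t = diagMetric Y' (d' t) (hd' t)) {K K' M M' : ℝ}
    (hK : 0 < K) (hK' : 0 < K') (hM : 0 < M) (h : DiagonalAsymptotics d K M)
    (h' : DiagonalAsymptotics d' K' M') :
    QuasiConverges g' g ↔ a₃ - b₃ = 0 ∧ a₁ - b₁ = 0 ∧ K' = K ∧ M' = M := by
  obtain ⟨a, ha⟩ : ∃ a, a = a₃ - b₃ := ⟨_, rfl⟩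
  obtain ⟨b, hb⟩ : ∃ b, b = a₁ - b₁ := ⟨_, rfl⟩
  obtain ⟨e, he⟩ : ∃ e, e = a₆ - b₆ - a * b₃ - b * b₁ := ⟨_, rfl⟩
  have hgram : ∀ᶠ t in atTop, ∀ i j, (g' t).gram Y i j = frameGram a b e (d' t) i j := by
    filter_upwards [eventually_ge_atTop 0] with t ht i j
    rw [hg' t ht]
    exact gram_frame_diagMetric X Y Y' hY hY' (d' t) (hd' t) ha hb he i j
  rw [quasiConverges_iff_components Y hd hg, ← ha, ← hb]
  constructor
  · intro H
    have H0 : Tendsto (fun t => d' t 0 + a ^ 2 * d' t 1 + b ^ 2 * d' t 2 + e ^ 2 * d' t 3 - d t 0)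
        atTop (𝓝 0) := by
      refine tendsto_zero_of_sq ?_
      have h1 := (H 0 0).mul (h.tendsto_0.mul h.tendsto_0)
      rw [zero_mul] at h1
      refine h1.congr' ?_
      filter_upwards [hgram] with t ht
      rw [ht, div_mul_cancel₀ _ (mul_pos (hd t 0) (hd t 0)).ne']
      simp [frameGram]
    -- The other terms are bounded, so the growing terms `a² B' + b² C'` converge.
    have H1 : Tendsto (fun t => a ^ 2 * d' t 1 + b ^ 2 * d' t 2) atTop
        (𝓝 (0 - M' / (2 * K') - e ^ 2 * 0 + M / (2 * K))) := by
      refine (((H0.sub h'.tendsto_0).sub (h'.tendsto_3_zero.const_mul (e ^ 2))).add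
        h.tendsto_0).congr fun t => ?_
      ring
    have H2 : a ^ 2 * (3 * K') ^ (1 / 3 : ℝ) + b ^ 2 * (3 * K') ^ (1 / 3 : ℝ) = 0 := by
      refine tendsto_nhds_unique ((h'.tendsto_1.const_mul (a ^ 2)).add
        (h'.tendsto_2.const_mul (b ^ 2))) ?_
      refine (H1.div_atTop (tendsto_rpow_atTop (by norm_num : (0 : ℝ) < 1 / 3))).congr fun t => ?_
      ring
    have hpos : 0 < (3 * K') ^ (1 / 3 : ℝ) := by positivity
    have hab : a ^ 2 + b ^ 2 = 0 := by
      rw [← add_mul] at H2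
      exact (mul_eq_zero.1 H2).resolve_right hpos.ne'
    have ha0 : a = 0 := by nlinarith [sq_nonneg a, sq_nonneg b]
    have hb0 : b = 0 := by nlinarith [sq_nonneg a, sq_nonneg b]
    have hKK : K' = K := by
      have h1 : Tendsto (fun t => d' t 1 / d t 1 - 1) atTop (𝓝 0) := by
        refine tendsto_zero_of_sq ((H 1 1).congr' ?_)
        filter_upwards [hgram] with t ht
        have := (hd t 1).ne'
        rw [ht]
        simp [frameGram, ha0]
        field_simp
      have h2 := tendsto_nhds_unique ((h.tendsto_div_1 h' hK).sub_const 1) h1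
      have h3 : (3 * K') ^ (1 / 3 : ℝ) = (3 * K) ^ (1 / 3 : ℝ) :=
        (div_eq_one_iff_eq (by positivity)).1 (sub_eq_zero.1 h2)
      have h4 := Real.rpow_left_injOn (by norm_num : (1 / 3 : ℝ) ≠ 0)
        (by positivity : 0 ≤ 3 * K') (by positivity : 0 ≤ 3 * K) h3
      linarith
    refine ⟨ha0, hb0, hKK, ?_⟩
    simp only [ha0, hb0, hKK] at H1
    have h1 := tendsto_nhds_unique H1 (by simp : Tendsto _ atTop (𝓝 (0 : ℝ)))
    field_simp at h1
    linarith
  · rintro ⟨rfl, rfl, rfl, rfl⟩ i j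
    have hq : ∀ {k : Fin 4}, Tendsto (fun t => d' t k / d t k) atTop (𝓝 1) →
        Tendsto (fun t => (d' t k - d t k) ^ 2 / (d t k * d t k)) atTop (𝓝 0) := by
      intro k hk
      have h1 := (hk.sub_const 1).pow 2
      simp only [sub_self, ne_eq, OfNat.ofNat_ne_zero, not_false_eq_true, zero_pow] at h1
      refine h1.congr fun t => ?_
      have := (hd t k).ne'
      field_simp
    have hr : (3 * K') ^ (1 / 3 : ℝ) / (3 * K') ^ (1 / 3 : ℝ) = 1 := div_self (by positivity)
    have q1 := hq (hr ▸ h.tendsto_div_1 h' hK)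
    have q2 := hq (hr ▸ h.tendsto_div_2 h' hK)
    have q3 := hq (h.tendsto_div_3 h' hK)
    have hA : M' / (2 * K') ≠ 0 := by positivity
    have q0 : Tendsto (fun t => (d' t 0 + e ^ 2 * d' t 3 - d t 0) ^ 2 / (d t 0 * d t 0)) atTop
        (𝓝 0) := by
      have h1 := (((h'.tendsto_0.add (h'.tendsto_3_zero.const_mul (e ^ 2))).sub
        h.tendsto_0).pow 2).div (h.tendsto_0.mul h.tendsto_0) (mul_ne_zero hA hA)
      simpa [Pi.div_def] using h1
    have q4 : Tendsto (fun t => (e * d' t 3) ^ 2 / (d t 0 * d t 3)) atTop (𝓝 0) := by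
      have h1 := ((h.tendsto_div_3 h' hK).mul (h'.tendsto_3_zero.const_mul (e ^ 2))).div
        h.tendsto_0 hA
      simp only [mul_zero, zero_div] at h1
      refine h1.congr fun t => ?_
      have := (hd t 0).ne'
      have := (hd t 3).ne'
      rw [Pi.div_apply]
      field_simp
    have q4' : Tendsto (fun t => (e * d' t 3) ^ 2 / (d t 3 * d t 0)) atTop (𝓝 0) :=
      q4.congr fun t => by rw [mul_comm (d t 0)]
    refine Tendsto.congr' (f₁ := fun t => (frameGram 0 0 e (d' t) i j -
      if i = j then d t i else 0) ^ 2 / (d t i * d t j)) ?_ ?_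
    · filter_upwards [hgram] with t ht
      rw [ht]
    · fin_cases i <;> fin_cases j <;> simp [frameGram] <;> assumption

end Asymptotics

theorem theorem9p1 {L : Type*} [LieRing L] [LieAlgebra ℝ L] [FiniteDimensional ℝ L]
    (X : Basis (Fin 4) ℝ L) (hX : IsU3I2Basis X)
    (a₁ a₃ a₆ : ℝ) (lam : Fin 4 → ℝ) (g : ℝ → InvMetric L) (hg : IsRicciFlow g)
    (hdiag : (g 0).IsDiagonal (frame X a₁ a₃ a₆) lam) :
    (∀ (b₁ b₃ b₆ : ℝ) (mu : Fin 4 → ℝ) (g' : ℝ → InvMetric L), IsRicciFlow g' →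
      (g' 0).IsDiagonal (frame X b₁ b₃ b₆) mu →
      (QuasiConverges g' g ↔
        a₃ - b₃ = 0 ∧ a₁ - b₁ = 0 ∧
        mu 1 * mu 2 * mu 3 ^ 2 = lam 1 * lam 2 * lam 3 ^ 2 ∧
        mu 0 * mu 3 * (mu 1 + mu 2) = lam 0 * lam 3 * (lam 1 + lam 2))) ∧
    (∀ b₁ b₃ b₆ : ℝ, a₃ - b₃ = 0 → a₁ - b₁ = 0 →
      classData (frame X b₁ b₃ b₆) g =
        {mu | (∀ i, 0 < mu i) ∧
          mu 1 * mu 2 * mu 3 ^ 2 = lam 1 * lam 2 * lam 3 ^ 2 ∧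
          mu 0 * mu 3 * (mu 1 + mu 2) = lam 0 * lam 3 * (lam 1 + lam 2)} ∧
      ∃ ψ : ℝ × ℝ → Fin 4 → ℝ,
        ContDiffOn ℝ ∞ ψ (Ioi 0 ×ˢ Ioi 0) ∧
        (∀ p ∈ Ioi (0 : ℝ) ×ˢ Ioi (0 : ℝ), ψ p 1 = p.1 ∧ ψ p 3 = p.2) ∧
        classData (frame X b₁ b₃ b₆) g = ψ '' (Ioi 0 ×ˢ Ioi 0)) := by
  have hpos : ∀ {c₁ c₃ c₆ : ℝ} {mu : Fin 4 → ℝ} {k : InvMetric L},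
      k.IsDiagonal (frame X c₁ c₃ c₆) mu → ∀ i, 0 < mu i := by
    intro c₁ c₃ c₆ mu k hk i
    obtain ⟨Z, hZ, -⟩ := hX.exists_frame c₁ c₃ c₆
    have := hk i i
    rw [if_pos rfl, ← hZ] at this
    exact this ▸ k.pos _ (Z.ne_zero i)
  -- By uniqueness, a flow with diagonal initial metric is the explicit diagonal one.
  have hflow : ∀ {c₁ c₃ c₆ : ℝ} {mu : Fin 4 → ℝ} {k : ℝ → InvMetric L}, IsRicciFlow k →
      (k 0).IsDiagonal (frame X c₁ c₃ c₆) mu → ∃ Z : Basis (Fin 4) ℝ L,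
        ⇑Z = frame X c₁ c₃ c₆ ∧ ∃ (d : ℝ → Fin 4 → ℝ) (hd : ∀ t i, 0 < d t i),
          (∀ t, 0 ≤ t → k t = diagMetric Z (d t) (hd t)) ∧
          DiagonalAsymptotics d (Real.sqrt (mu 1 * mu 2) * mu 3)
            (mu 0 * mu 3 * (mu 1 + mu 2)) := by
    intro c₁ c₃ c₆ mu k hk hk0
    obtain ⟨Z, hZ, hZU⟩ := hX.exists_frame c₁ c₃ c₆
    obtain ⟨d, hd, hd0, hdf, has⟩ := hZU.exists_diagonal_flow (hpos hk0) rfl rfl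
    refine ⟨Z, hZ, d, hd, fun t ht => hk.eq_of_eq_zero Z hdf ?_ ht, has⟩
    refine InvMetric.eq_of_gram_eq Z ?_
    ext i j
    rw [diagMetric_gram, hd0, InvMetric.gram, hZ]
    exact hk0 i j
  have hlam := hpos hdiag
  have l0 := hlam 0
  have l1 := hlam 1
  have l2 := hlam 2
  have l3 := hlam 3
  have hiff : ∀ (b₁ b₃ b₆ : ℝ) (mu : Fin 4 → ℝ) (g' : ℝ → InvMetric L), IsRicciFlow g' →
      (g' 0).IsDiagonal (frame X b₁ b₃ b₆) mu →
      (QuasiConverges g' g ↔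
        a₃ - b₃ = 0 ∧ a₁ - b₁ = 0 ∧
        mu 1 * mu 2 * mu 3 ^ 2 = lam 1 * lam 2 * lam 3 ^ 2 ∧
        mu 0 * mu 3 * (mu 1 + mu 2) = lam 0 * lam 3 * (lam 1 + lam 2)) := by
    intro b₁ b₃ b₆ mu g' hg' hdiag'
    have hmu := hpos hdiag'
    have m1 := hmu 1
    have m2 := hmu 2
    have m3 := hmu 3
    obtain ⟨Y, hY, d, hd, hgd, has⟩ := hflow hg hdiag
    obtain ⟨Y', hY', d', hd', hgd', has'⟩ := hflow hg' hdiag'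
    have hK : 0 < Real.sqrt (lam 1 * lam 2) * lam 3 := by positivity
    have hK' : 0 < Real.sqrt (mu 1 * mu 2) * mu 3 := by positivity
    rw [quasiConverges_diagonal_iff X Y Y' hY hY' hd hd' hgd hgd' hK hK' (by positivity) has has',
      ← sq_eq_sq₀ hK'.le hK.le, mul_pow, mul_pow, Real.sq_sqrt (by positivity),
      Real.sq_sqrt (by positivity)]
  have hclass : ∀ b₁ b₃ b₆ : ℝ, a₃ - b₃ = 0 → a₁ - b₁ = 0 →
      classData (frame X b₁ b₃ b₆) g =
        {mu | (∀ i, 0 < mu i) ∧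
          mu 1 * mu 2 * mu 3 ^ 2 = lam 1 * lam 2 * lam 3 ^ 2 ∧
          mu 0 * mu 3 * (mu 1 + mu 2) = lam 0 * lam 3 * (lam 1 + lam 2)} := by
    intro b₁ b₃ b₆ ha hb
    ext mu
    constructor
    · rintro ⟨g', hg', hdiag', hq⟩
      exact ⟨hpos hdiag', ((hiff _ _ _ _ _ hg' hdiag').1 hq).2.2⟩
    · rintro ⟨hmu, h1, h2⟩
      obtain ⟨Z, hZ, hZU⟩ := hX.exists_frame b₁ b₃ b₆
      obtain ⟨d, hd, hd0, hdf, -⟩ := hZU.exists_diagonal_flow hmu rfl rfl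
      have hdiag' : (diagMetric Z (d 0) (hd 0)).IsDiagonal (frame X b₁ b₃ b₆) mu := by
        intro i j
        rw [← hZ, ← hd0]
        exact diagMetric_gram Z (d 0) (hd 0) i j
      exact ⟨_, hdf, hdiag', (hiff _ _ _ _ _ hdf hdiag').2 ⟨ha, hb, h1, h2⟩⟩
  refine ⟨hiff, fun b₁ b₃ b₆ ha hb => ⟨hclass b₁ b₃ b₆ ha hb, ?_⟩⟩
  obtain ⟨Q, hQ, hQpos⟩ : ∃ Q, Q = lam 1 * lam 2 * lam 3 ^ 2 ∧ 0 < Q := ⟨_, rfl, by positivity⟩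
  obtain ⟨M, hM, hMpos⟩ : ∃ M, M = lam 0 * lam 3 * (lam 1 + lam 2) ∧ 0 < M :=
    ⟨_, rfl, by positivity⟩
  rw [hclass b₁ b₃ b₆ ha hb, ← hQ, ← hM]
  -- Given the second and the fourth entry, the first equation determines the third one, and then the
  -- second equation determines the first one.
  refine ⟨fun p => ![M / (p.2 * (p.1 + Q / (p.1 * p.2 ^ 2))), p.1, Q / (p.1 * p.2 ^ 2), p.2],
    ?_, fun p _ => ⟨rfl, rfl⟩, ?_⟩
  · have c1 : ContDiffOn ℝ ∞ (fun p : ℝ × ℝ => p.1) (Ioi 0 ×ˢ Ioi 0) := contDiffOn_fst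
    have c2 : ContDiffOn ℝ ∞ (fun p : ℝ × ℝ => p.2) (Ioi 0 ×ˢ Ioi 0) := contDiffOn_snd
    have c3 : ContDiffOn ℝ ∞ (fun p : ℝ × ℝ => Q / (p.1 * p.2 ^ 2)) (Ioi 0 ×ˢ Ioi 0) := by
      refine contDiffOn_const.div (c1.mul (c2.pow 2)) ?_
      rintro ⟨x, y⟩ ⟨hx, hy⟩
      rw [mem_Ioi] at hx hy
      positivity
    have c4 : ContDiffOn ℝ ∞ (fun p : ℝ × ℝ => M / (p.2 * (p.1 + Q / (p.1 * p.2 ^ 2))))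
        (Ioi 0 ×ˢ Ioi 0) := by
      refine contDiffOn_const.div (c2.mul (c1.add c3)) ?_
      rintro ⟨x, y⟩ ⟨hx, hy⟩
      rw [mem_Ioi] at hx hy
      positivity
    refine contDiffOn_pi.2 fun i => ?_
    fin_cases i
    exacts [c4, c1, c3, c2]
  · ext mu
    constructor
    · rintro ⟨hmu, h1, h2⟩
      have m0 := hmu 0
      have m1 := hmu 1
      have m2 := hmu 2
      have m3 := hmu 3
      have e2 : Q / (mu 1 * mu 3 ^ 2) = mu 2 := by
        rw [← h1]
        field_simp
      refine ⟨(mu 1, mu 3), ⟨m1, m3⟩, ?_⟩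
      ext i
      fin_cases i
      · simp only [e2, ← h2]
        simp
        field_simp
      · rfl
      · exact e2
      · rfl
    · rintro ⟨⟨x, y⟩, ⟨hx, hy⟩, rfl⟩
      simp only [mem_Ioi] at hx hy
      refine ⟨fun i => ?_, ?_, ?_⟩
      · fin_cases i <;> simp <;> positivity
      · simp
        field_simp
      · simp
        field_simp
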